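/- Let $(X,\|\cdot\|)$ be a finite-dimensional real normed space whose norm is strictly convex and smooth, where smooth means that every unit vector $u$ has exactly one supporting functional $f_u$, i.e. exactly one linear functional with $\|f_u\|^*=1$ and $f_u(u)=1$. Let $[x,y]:=f_y(x)$ be the semi-inner product induced by the norm, where $f_{\lambda u}:=\lambda f_u$ for $\|u\|=1$ and $\lambda\in\mathbb{R}$. For $m\in X$ define the left and right semi-polars $$m_\circ=\{x\in X:[m,x]\le 1\},\qquad m^\circ=\{x\in X:[x,m]\le 1\},$$ and for $M\subseteq X$ put $M_\circ=\bigcap_{m\in M}m_\circ$ and $M^\circ=\bigcap_{m\in M}m^\circ$. Then the following are equivalent: (i) $X$ is an inner product space, i.e. its norm is induced by an inner product; (ii) for every $m\in X$, the set $m_\circ$ is convex; (iii) for every $m\in X$, $m\in(m^\circ)^\circ$; (iv) for every $m\in X$, $m\in(m_\circ)_\circ$. -/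

import Mathlib

/-- The norm of `X` is smooth: every unit vector has exactly one supporting functional of norm
one. -/
def IsSmoothNorm (X : Type*) [NormedAddCommGroup X] [NormedSpace ℝ X] : Prop :=
  ∀ u : X, ‖u‖ = 1 → ∃! f : StrongDual ℝ X, ‖f‖ = 1 ∧ f u = 1

/-- Hahn-Banach: every nonzero vector, after normalization, has a supporting functional of norm
one. -/
theorem exists_supportingFunctional {X : Type*} [NormedAddCommGroup X] [NormedSpace ℝ X]
    {y : X} (hy : y ≠ 0) : ∃ f : StrongDual ℝ X, ‖f‖ = 1 ∧ f (‖y‖⁻¹ • y) = 1 := by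
  obtain ⟨f, hf, hfy⟩ := exists_dual_vector ℝ y (norm_ne_zero_iff.mpr hy)
  refine ⟨f, hf, ?_⟩
  have h : ‖y‖ ≠ 0 := norm_ne_zero_iff.mpr hy
  have hfy' : f y = ‖y‖ := by simpa using hfy
  rw [map_smul, hfy', smul_eq_mul, inv_mul_cancel₀ h]

open Classical in
/-- The functional `f_y`: for a unit vector `u` it is a functional of norm one with `f_u u = 1`
(unique when the norm is smooth), and `f_y = ‖y‖ • f_u` for `y = ‖y‖ • u`; also `f_0 = 0`. -/
noncomputable def dualityFunctional {X : Type*} [NormedAddCommGroup X] [NormedSpace ℝ X]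
    (y : X) : StrongDual ℝ X :=
  if hy : y = 0 then 0 else ‖y‖ • Classical.choose (exists_supportingFunctional hy)

/-- The semi-inner product `[x, y] = f_y x` induced by the norm. -/
noncomputable def semiInner {X : Type*} [NormedAddCommGroup X] [NormedSpace ℝ X]
    (x y : X) : ℝ :=
  dualityFunctional y x

/-- The left semi-polar `m_∘ = {x | [m, x] ≤ 1}` of a point. -/
def leftSemipolarPoint {X : Type*} [NormedAddCommGroup X] [NormedSpace ℝ X] (m : X) : Set X :=
  {x | semiInner m x ≤ 1}

/-- The right semi-polar `m^∘ = {x | [x, m] ≤ 1}` of a point. -/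
def rightSemipolarPoint {X : Type*} [NormedAddCommGroup X] [NormedSpace ℝ X] (m : X) : Set X :=
  {x | semiInner x m ≤ 1}

/-- The left semi-polar `M_∘` of a set. -/
def leftSemipolar {X : Type*} [NormedAddCommGroup X] [NormedSpace ℝ X] (M : Set X) : Set X :=
  ⋂ m ∈ M, leftSemipolarPoint m

/-- The right semi-polar `M^∘` of a set. -/
def rightSemipolar {X : Type*} [NormedAddCommGroup X] [NormedSpace ℝ X] (M : Set X) : Set X :=
  ⋂ m ∈ M, rightSemipolarPoint m

/-- The given normed space is an inner product space: there is an inner product, for its own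
vector space structure, that induces its norm. -/
def IsInnerProductNormedSpace (X : Type*) [NormedAddCommGroup X] [E : NormedSpace ℝ X] : Prop :=
  ∃ I : InnerProductSpace ℝ X, I.toNormedSpace = E

/-!
The semi-inner product `[x, y] = f_y x` is linear in `x`, homogeneous in `y` and satisfies
`[x, x] = ‖x‖ ^ 2`. As soon as it is additive in `y`, its symmetrization is therefore an inner
product inducing the norm (`isInnerProductNormedSpace_of_semiInner_add_right`). Conversely, if the
norm comes from an inner product, then uniqueness of supporting functionals forces `[x, y]` to be
that inner product (`semiInner_eq_inner`), which gives all the other properties.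

Both bipolar conditions say that `[x, y] ≤ 1` implies `[y, x] ≤ 1`. By homogeneity this makes the
semi-inner product symmetric (`semiInner_comm_of_le_one`), hence additive in `y`.

Suppose the sets `m_∘` are convex. If `[m, k] = 0`, then `m_∘` contains the whole line `ℝ k`, and a
convex set containing a line is, up to closure, invariant under translations along it; by
homogeneity this yields `[m, k + x] = [m, x]` (`semiInner_add_right_of_eq_zero`). On the other
hand, taking the best approximation of a vector in `ℝ m` writes every vector as `k + t • m` with
`[m, k] = 0` (`exists_semiInner_sub_smul_eq_zero`): by uniqueness, a norming functional of the
remainder that vanishes on `m` is a multiple of its duality functional. On such a decomposition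
`[m, k + t • m] = t * [m, m]`, so `[m, ·]` is additive.
-/

section SemiInner

variable {X : Type*} [NormedAddCommGroup X] [NormedSpace ℝ X]

theorem dualityFunctional_apply_self (y : X) : dualityFunctional y y = ‖y‖ ^ 2 := by
  by_cases hy : y = 0
  · simp [dualityFunctional, hy]
  · have h := (Classical.choose_spec (exists_supportingFunctional hy)).2
    have hn : ‖y‖ ≠ 0 := norm_ne_zero_iff.mpr hy
    rw [map_smul, smul_eq_mul, inv_mul_eq_one₀ hn] at h
    simp only [dualityFunctional, dif_neg hy, smul_apply, smul_eq_mul]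
    rw [← h, sq]

theorem norm_dualityFunctional (y : X) : ‖dualityFunctional y‖ = ‖y‖ := by
  by_cases hy : y = 0
  · simp [dualityFunctional, hy]
  · have h := (Classical.choose_spec (exists_supportingFunctional hy)).1
    rw [dualityFunctional, dif_neg hy, norm_smul, norm_norm, h, mul_one]

/-- If the norm is smooth, then `f_y` is characterized by `‖f_y‖ ≤ ‖y‖` and `f_y y = ‖y‖ ^ 2`. -/
theorem eq_dualityFunctional (hX : IsSmoothNorm X) {y : X} {f : StrongDual ℝ X}
    (hf : ‖f‖ ≤ ‖y‖) (hfy : f y = ‖y‖ ^ 2) : f = dualityFunctional y := by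
  by_cases hy : y = 0
  · simpa [dualityFunctional, hy] using hf
  have hn : 0 < ‖y‖ := norm_pos_iff.mpr hy
  have key : ∀ g : StrongDual ℝ X, ‖g‖ ≤ ‖y‖ → g y = ‖y‖ ^ 2 →
      ‖‖y‖⁻¹ • g‖ = 1 ∧ (‖y‖⁻¹ • g) (‖y‖⁻¹ • y) = 1 := by
    intro g hg hgy
    have hle : ‖y‖ ≤ ‖g‖ := by
      have := (le_abs_self _).trans (g.le_opNorm y)
      rw [hgy] at this
      nlinarith
    refine ⟨?_, ?_⟩
    · rw [norm_smul, norm_inv, norm_norm, le_antisymm hg hle, inv_mul_cancel₀ hn.ne']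
    · simp only [smul_apply, map_smul, smul_eq_mul, hgy]
      field_simp
  have huniq := (hX (‖y‖⁻¹ • y) (norm_smul_inv_norm hy)).unique (key f hf hfy)
    (key _ (norm_dualityFunctional y).le (dualityFunctional_apply_self y))
  exact smul_right_injective _ (inv_ne_zero hn.ne') huniq

theorem semiInner_self (x : X) : semiInner x x = ‖x‖ ^ 2 := dualityFunctional_apply_self x

theorem semiInner_add_left (x x' y : X) :
    semiInner (x + x') y = semiInner x y + semiInner x' y := map_add _ _ _

theorem semiInner_smul_left (c : ℝ) (x y : X) : semiInner (c • x) y = c * semiInner x y :=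
  map_smul _ _ _

theorem semiInner_smul_right (hX : IsSmoothNorm X) (c : ℝ) (x y : X) :
    semiInner x (c • y) = c * semiInner x y := by
  have h : c • dualityFunctional y = dualityFunctional (c • y) := by
    refine eq_dualityFunctional hX ?_ ?_
    · rw [norm_smul, norm_smul, norm_dualityFunctional]
    · simp only [smul_apply, map_smul, smul_eq_mul,
        dualityFunctional_apply_self, norm_smul, mul_pow, Real.norm_eq_abs, sq_abs]
      ring
  simp [semiInner, ← h]

theorem semiInner_neg_left (x y : X) : semiInner (-x) y = -semiInner x y := map_neg _ _

theorem semiInner_neg_right (hX : IsSmoothNorm X) (x y : X) :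
    semiInner x (-y) = -semiInner x y := by
  simpa using semiInner_smul_right hX (-1) x y

/-- The inner product is the symmetrization of the semi-inner product. -/
theorem isInnerProductNormedSpace_of_semiInner_add_right (hX : IsSmoothNorm X)
    (hadd : ∀ x y z : X, semiInner x (y + z) = semiInner x y + semiInner x z) :
    IsInnerProductNormedSpace X := by
  refine ⟨{ ‹NormedSpace ℝ X› with
    inner := fun x y => (semiInner x y + semiInner y x) / 2
    norm_sq_eq_re_inner := ?_
    conj_inner_symm := ?_
    add_left := ?_
    smul_left := ?_ }, rfl⟩
  · intro x
    simp [semiInner_self]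
  · intro x y
    simp [add_comm]
  · intro x y z
    simp only [semiInner_add_left, hadd]
    ring
  · intro x y r
    simp only [semiInner_smul_left, semiInner_smul_right hX, conj_trivial]
    ring

theorem semiInner_comm_of_le_one (hX : IsSmoothNorm X)
    (h : ∀ x y : X, semiInner x y ≤ 1 → semiInner y x ≤ 1) (x y : X) :
    semiInner x y = semiInner y x := by
  have scaled : ∀ c : ℝ, 0 < c → ∀ x y : X, semiInner x y ≤ c → semiInner y x ≤ c := by
    intro c hc x y hxy
    have := h (c⁻¹ • x) y (by
      rw [semiInner_smul_left, inv_mul_le_iff₀ hc]; simpa using hxy)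
    rw [semiInner_smul_right hX, inv_mul_le_iff₀ hc] at this
    simpa using this
  have nonpos : ∀ x y : X, semiInner x y ≤ 0 → semiInner y x ≤ 0 := fun x y hxy =>
    le_of_forall_pos_le_add fun c hc => by
      simpa using scaled c hc x y (hxy.trans hc.le)
  have le : ∀ x y : X, 0 ≤ semiInner x y → semiInner y x ≤ semiInner x y := by
    intro x y hxy
    rcases hxy.eq_or_lt with h0 | hpos
    · rw [← h0]
      exact nonpos x y h0.ge
    · exact scaled _ hpos x y le_rfl
  have nonneg : ∀ x y : X, 0 ≤ semiInner x y → 0 ≤ semiInner y x := by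
    intro x y hxy
    have := nonpos (-x) y (by rw [semiInner_neg_left]; linarith)
    rw [semiInner_neg_right hX] at this
    linarith
  have eq : ∀ x y : X, 0 ≤ semiInner x y → semiInner x y = semiInner y x := fun x y hxy =>
    le_antisymm (le y x (nonneg x y hxy)) (le x y hxy)
  rcases le_total 0 (semiInner x y) with hxy | hxy
  · exact eq x y hxy
  · have := eq (-x) y (by rw [semiInner_neg_left]; linarith)
    rw [semiInner_neg_left, semiInner_neg_right hX] at this
    linarith

theorem isInnerProductNormedSpace_of_semiInner_comm (hX : IsSmoothNorm X)
    (h : ∀ x y : X, semiInner x y = semiInner y x) : IsInnerProductNormedSpace X :=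
  isInnerProductNormedSpace_of_semiInner_add_right hX fun x y z => by
    rw [h x, semiInner_add_left, h y, h z]

/-- If `m_∘` is convex, then `[m, ·]` is invariant under translation by any `k` with
`[m, k] = 0`. -/
theorem semiInner_add_right_of_eq_zero (hX : IsSmoothNorm X) {m k : X}
    (hm : Convex ℝ (leftSemipolarPoint m)) (hk : semiInner m k = 0) (x : X) :
    semiInner m (k + x) = semiInner m x := by
  -- `k + x` is a convex combination of `(1 - a)⁻¹ • k` and `a⁻¹ • x`, which both lie in `m_∘` when
  -- `[m, x] < a < 1`. The strict inequality leaves room for `a`, so `m_∘` need not be closed.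
  have lt_one : ∀ k x : X, semiInner m k = 0 → semiInner m x < 1 → semiInner m (k + x) ≤ 1 := by
    intro k x hk hx
    obtain ⟨a, ha, ha1⟩ := exists_between (max_lt hx one_pos)
    have ha0 : 0 < a := (le_max_right _ _).trans_lt ha
    have hxa : semiInner m x < a := (le_max_left _ _).trans_lt ha
    have h1a : 0 < 1 - a := sub_pos.mpr ha1
    have hk' : (1 - a)⁻¹ • k ∈ leftSemipolarPoint m := by
      change semiInner m _ ≤ 1
      simp [semiInner_smul_right hX, hk]
    have hx' : a⁻¹ • x ∈ leftSemipolarPoint m := by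
      change semiInner m _ ≤ 1
      rw [semiInner_smul_right hX, inv_mul_le_iff₀ ha0]
      simpa using hxa.le
    have := hm hk' hx' h1a.le ha0.le (by ring)
    rwa [smul_inv_smul₀ h1a.ne', smul_inv_smul₀ ha0.ne'] at this
  have lt : ∀ k x : X, semiInner m k = 0 → ∀ c : ℝ, 0 < c → semiInner m x < c →
      semiInner m (k + x) ≤ c := by
    intro k x hk c hc hx
    have := lt_one (c⁻¹ • k) (c⁻¹ • x) (by simp [semiInner_smul_right hX, hk])
      (by rw [semiInner_smul_right hX, inv_mul_lt_iff₀ hc]; simpa using hx)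
    rw [← smul_add, semiInner_smul_right hX, inv_mul_le_iff₀ hc] at this
    simpa using this
  have le : ∀ k x : X, semiInner m k = 0 → semiInner m (k + x) ≤ max (semiInner m x) 0 := by
    intro k x hk
    refine le_of_forall_gt_imp_ge_of_dense fun c hc => ?_
    exact lt k x hk c ((le_max_right _ _).trans_lt hc) ((le_max_left _ _).trans_lt hc)
  have hk' : semiInner m (-k) = 0 := by rw [semiInner_neg_right hX, hk, neg_zero]
  have h1 := le k x hk
  have h2 := le (-k) (k + x) hk'
  have h3 := le (-k) (-x) hk'
  have h4 := le k (-k + -x) hk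
  rw [neg_add_cancel_left] at h2
  rw [add_neg_cancel_left] at h4
  rw [← neg_add] at h3 h4
  simp only [semiInner_neg_right hX] at h3 h4
  simp only [le_max_iff] at h1 h2 h3 h4
  rcases h1 with h1 | h1 <;> rcases h2 with h2 | h2 <;> rcases h3 with h3 | h3 <;>
    rcases h4 with h4 | h4 <;> apply le_antisymm <;> linarith

/-- Every vector differs by a multiple of `m` from a vector to which `m` is orthogonal: subtract
its best approximation in `ℝ m`. -/
theorem exists_semiInner_sub_smul_eq_zero [FiniteDimensional ℝ X] (hX : IsSmoothNorm X) (m x : X) :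
    ∃ t : ℝ, semiInner m (x - t • m) = 0 := by
  let S : Submodule ℝ X := Submodule.span ℝ {m}
  have hS : IsClosed (S : Set X) := S.closed_of_finiteDimensional
  obtain ⟨p, hpS, hp⟩ := hS.exists_infDist_eq_dist ⟨0, S.zero_mem⟩ x
  obtain ⟨t, rfl⟩ := Submodule.mem_span_singleton.mp hpS
  refine ⟨t, ?_⟩
  set y := x - t • m with hy
  have hnorm : ‖S.mkQ y‖ = ‖y‖ := by
    have h1 : S.mkQ y = S.mkQ x := by
      have h0 : S.mkQ (t • m) = 0 := (Submodule.Quotient.mk_eq_zero S).mpr hpS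
      rw [hy, map_sub, h0, sub_zero]
    rw [h1]
    have h2 : ‖S.mkQ x‖ = Metric.infDist x S := QuotientAddGroup.norm_mk (S := S.toAddSubgroup) x
    rw [h2, hp, dist_eq_norm]
  -- A norming functional of the class of `y` in `X ⧸ ℝ m` pulls back to a multiple of `f_y`.
  obtain ⟨g, hg, hgy⟩ := exists_dual_vector'' ℝ (S.mkQ y)
  let f : StrongDual ℝ X := ‖y‖ • LinearMap.mkContinuous (g.toLinearMap ∘ₗ S.mkQ) 1 fun z => by
    rw [one_mul]
    refine (g.le_of_opNorm_le hg _).trans ?_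
    rw [one_mul]
    exact Submodule.Quotient.norm_mk_le S z
  have hf : f = dualityFunctional y := by
    refine eq_dualityFunctional hX ?_ ?_
    · rw [norm_smul, norm_norm]
      exact mul_le_of_le_one_right (norm_nonneg _) (LinearMap.mkContinuous_norm_le _ zero_le_one _)
    · have : f y = ‖y‖ * g (S.mkQ y) := rfl
      rw [this, hgy, hnorm, sq]
      rfl
  have hm : S.mkQ m = 0 :=
    (Submodule.Quotient.mk_eq_zero S).mpr (Submodule.mem_span_singleton_self m)
  have : f m = ‖y‖ * g (S.mkQ m) := rfl
  rw [semiInner, ← hf, this, hm, map_zero, mul_zero]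

theorem semiInner_add_right_of_convex [FiniteDimensional ℝ X] (hX : IsSmoothNorm X) {m : X}
    (hm : Convex ℝ (leftSemipolarPoint m)) (x y : X) :
    semiInner m (x + y) = semiInner m x + semiInner m y := by
  obtain ⟨s, hs⟩ := exists_semiInner_sub_smul_eq_zero hX m x
  obtain ⟨t, ht⟩ := exists_semiInner_sub_smul_eq_zero hX m y
  have hx := semiInner_add_right_of_eq_zero hX hm hs (s • m)
  have hy := semiInner_add_right_of_eq_zero hX hm ht (t • m)
  have hxy := semiInner_add_right_of_eq_zero hX hm hs ((y - t • m) + (s + t) • m)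
  rw [semiInner_add_right_of_eq_zero hX hm ht] at hxy
  have hsum : x - s • m + (y - t • m + (s + t) • m) = x + y := by module
  rw [hsum] at hxy
  rw [sub_add_cancel] at hx hy
  rw [hx, hy, hxy]
  simp only [semiInner_smul_right hX]
  ring

end SemiInner

theorem semiInner_eq_inner {X : Type*} [NormedAddCommGroup X] [InnerProductSpace ℝ X]
    (hX : IsSmoothNorm X) (x y : X) : semiInner x y = inner ℝ y x := by
  have h : innerSL ℝ y = dualityFunctional y :=
    eq_dualityFunctional hX (innerSL_apply_norm ℝ y).le (by simp)
  rw [semiInner, ← h, innerSL_apply_apply]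

theorem IsInnerProductNormedSpace.semiInner_comm {X : Type*} [NormedAddCommGroup X]
    [NormedSpace ℝ X] (h : IsInnerProductNormedSpace X) (hX : IsSmoothNorm X) (x y : X) :
    semiInner x y = semiInner y x := by
  obtain ⟨I, rfl⟩ := h
  rw [semiInner_eq_inner hX, semiInner_eq_inner hX, real_inner_comm]

theorem theorem5p4 {X : Type*} [NormedAddCommGroup X] [NormedSpace ℝ X] [FiniteDimensional ℝ X]
    [StrictConvexSpace ℝ X] (hsmooth : IsSmoothNorm X) :
    List.TFAE [
      IsInnerProductNormedSpace X,
      ∀ m : X, Convex ℝ (leftSemipolarPoint m),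
      ∀ m : X, m ∈ rightSemipolar (rightSemipolarPoint m),
      ∀ m : X, m ∈ leftSemipolar (leftSemipolarPoint m)] := by
  tfae_have 1 → 2 := by
    intro h m
    have hset : leftSemipolarPoint m = {x | dualityFunctional m x ≤ 1} := by
      ext x
      change semiInner m x ≤ 1 ↔ semiInner x m ≤ 1
      rw [h.semiInner_comm hsmooth]
    rw [hset]
    exact convex_halfSpace_le (dualityFunctional m).toLinearMap.isLinear 1
  tfae_have 2 → 1 := fun h =>
    isInnerProductNormedSpace_of_semiInner_add_right hsmooth fun m =>
      semiInner_add_right_of_convex hsmooth (h m)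
  tfae_have 1 → 3 := fun h m => Set.mem_iInter₂.mpr fun x (hx : semiInner x m ≤ 1) =>
    show semiInner m x ≤ 1 from (h.semiInner_comm hsmooth m x).trans_le hx
  tfae_have 3 → 4 := fun h m => Set.mem_iInter₂.mpr fun x (hx : semiInner m x ≤ 1) =>
    show semiInner x m ≤ 1 from Set.mem_iInter₂.mp (h x) m hx
  tfae_have 4 → 1 := fun h =>
    isInnerProductNormedSpace_of_semiInner_comm hsmooth <|
      semiInner_comm_of_le_one hsmooth fun x y hxy => Set.mem_iInter₂.mp (h x) y hxy
  tfae_finish
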